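/- **Theorem 3.1 (asymptotic triangle inequality).** For each integer $n\ge 2$ let $A_n,B_n,C_n$ be independent random matrices, each uniformly distributed on the unit sphere $\mathbb S_n=\{X\in\mathbb R^{n\times n}:\|X\|_F=1\}$ of the real $n\times n$ matrices with respect to the Frobenius norm $\|X\|_F=\bigl(\sum_{i,j}X_{ij}^2\bigr)^{1/2}$. Let $\alpha=1$ or $\alpha=2$, put $d_\alpha(X,Y)=\|XY-YX\|_F^{\alpha}$ and $$\Delta_\alpha(X,Y,Z)=d_\alpha(X,Y)+d_\alpha(Y,Z)-d_\alpha(X,Z).$$ Then $$\lim_{n\to\infty}\mathrm P\bigl(\Delta_\alpha(A_n,B_n,C_n)<0\bigr)=0,\qquad\text{and moreover}\qquad \mathrm P\bigl(\Delta_\alpha(A_n,B_n,C_n)<0\bigr)=O(n^{-2})\quad (n\to\infty).$$ -/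

import Mathlib

open MeasureTheory ProbabilityTheory Filter Asymptotics
open scoped Topology ENNReal

noncomputable section

/-- The (product, equivalently Borel) sigma-algebra on real square matrices. -/
instance matrixMeasurableSpace (n : ℕ) : MeasurableSpace (Matrix (Fin n) (Fin n) ℝ) :=
  inferInstanceAs (MeasurableSpace (Fin n → Fin n → ℝ))

/-- The normalized surface measure on the unit sphere of the Euclidean space `ℝ^(n × n)`. For
`n ≠ 0` it is a probability measure. -/
def uniformOnUnitSphere (n : ℕ) :
    Measure (Metric.sphere (0 : EuclideanSpace ℝ (Fin n × Fin n)) 1) :=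
  ((volume : Measure (EuclideanSpace ℝ (Fin n × Fin n))).toSphere Set.univ)⁻¹ •
    (volume : Measure (EuclideanSpace ℝ (Fin n × Fin n))).toSphere

/-- The uniform distribution on the sphere of `n × n` real matrices of Frobenius norm `1`, as a
measure on the space of all matrices: the matrix with entries `x (i, j)` has Frobenius norm equal
to the Euclidean norm of `x`. -/
def uniformUnitMatrix (n : ℕ) : Measure (Matrix (Fin n) (Fin n) ℝ) :=
  (uniformOnUnitSphere n).map fun x => Matrix.of fun i j => x.1 (i, j)

section Frobenius

attribute [local instance] Matrix.frobeniusNormedAddCommGroup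

/-- `d_α(X, Y) = ‖XY - YX‖_F ^ α`. The norm is the Frobenius norm. -/
def commutatorDist {n : ℕ} (α : ℝ) (X Y : Matrix (Fin n) (Fin n) ℝ) : ℝ :=
  ‖X * Y - Y * X‖ ^ α

end Frobenius

/-- The triangle inequality defect `Δ_α(A, B, C) = d_α(A, B) + d_α(B, C) - d_α(A, C)`. -/
def triangleDefect {n : ℕ} (α : ℝ) (A B C : Matrix (Fin n) (Fin n) ℝ) : ℝ :=
  commutatorDist α A B + commutatorDist α B C - commutatorDist α A C

end

/-! For independent uniform `X`, `Y` the quantity `n‖XY - YX‖²` concentrates at 2. If all three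
commutators lie within 2/3 of this value, then two of them sum to more than 4/3 + 4/3 = 8/3 while
the third is below 8/3, so the defect cannot be negative. A union bound over the three pairs then
reduces everything to a single deviation estimate, of order `n⁻²`.

That estimate is Chebyshev's inequality. For fixed `Y` the squared norm is a quadratic form in `X`,
a sum of squared inner products, so its first two moments follow from the second and fourth moments
on the sphere (`integral_inner_mul_inner`, `integral_inner_four`), which rotation invariance
determines. The mean of `n‖XY - YX‖²` given `Y` is `2 - 2 (tr Y)² / n`, and the fluctuation is
governed by the Gram matrix of the commutator rows (`sum_inner_commutatorRow_sq_le`). Averaging over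
`Y` gives `integral_integral_sub_sq_le`. -/

/-! ### Second and fourth moments of a rotation-invariant measure on the sphere. -/

section SphereMoments

open scoped RealInnerProductSpace Pointwise

variable {E : Type*} [NormedAddCommGroup E] [InnerProductSpace ℝ E]

theorem sum_inner_sq_eq_one [FiniteDimensional ℝ E] (x : Metric.sphere (0 : E) 1) :
    ∑ i, ⟪stdOrthonormalBasis ℝ E i, x.1⟫ ^ 2 = 1 := by
  have := (stdOrthonormalBasis ℝ E).sum_sq_norm_inner_right x.1
  simpa using this

variable [MeasurableSpace E]

/-- A measure on the unit sphere is rotation invariant if every linear isometry preserves its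
image in the ambient space. -/
def IsRotationInvariant (σ : Measure (Metric.sphere (0 : E) 1)) : Prop :=
  ∀ e : E ≃ₗᵢ[ℝ] E, σ.map (fun x => e x.1) = σ.map Subtype.val

variable {σ : Measure (Metric.sphere (0 : E) 1)}

theorem IsRotationInvariant.smul (h : IsRotationInvariant σ) (c : ℝ≥0∞) :
    IsRotationInvariant (c • σ) := fun e => by
  rw [Measure.map_smul, Measure.map_smul, h e]

variable [BorelSpace E]

/-- Up to a factor, the surface measure of a set is the volume of the cone over it; isometries carry
cones to cones and preserve volume. -/
theorem isRotationInvariant_toSphere [FiniteDimensional ℝ E] :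
    IsRotationInvariant (volume : Measure E).toSphere := by
  intro e
  ext s hs
  have hme : Measurable (fun x : Metric.sphere (0 : E) 1 => e x.1) :=
    e.continuous.measurable.comp measurable_subtype_coe
  rw [Measure.map_apply hme hs, Measure.map_apply measurable_subtype_coe hs,
    Measure.toSphere_apply' _ (hme hs), Measure.toSphere_apply' _ (measurable_subtype_coe hs)]
  congr 1
  have key : Set.Ioo (0 : ℝ) 1 • (Subtype.val '' ((fun x : Metric.sphere (0 : E) 1 => e x.1) ⁻¹' s))
      = e ⁻¹' (Set.Ioo (0 : ℝ) 1 • (Subtype.val '' (Subtype.val ⁻¹' s :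
        Set (Metric.sphere (0 : E) 1)))) := by
    ext y
    simp only [Set.mem_smul, Set.mem_preimage, Set.mem_image, Subtype.exists, exists_and_right,
      exists_eq_right, mem_sphere_zero_iff_norm]
    constructor
    · rintro ⟨r, hr, z, ⟨hz, hzs⟩, rfl⟩
      exact ⟨r, hr, e z, ⟨by simpa using hz, hzs⟩, by simp⟩
    · rintro ⟨r, hr, z, ⟨hz, hzs⟩, h⟩
      refine ⟨r, hr, e.symm z, ⟨by simpa using hz, by simpa using hzs⟩, ?_⟩
      apply e.injective
      simp [h]
  rw [key]
  exact e.measurePreserving.measure_preimage_emb e.toHomeomorph.measurableEmbedding _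

theorem IsRotationInvariant.integral_comp (h : IsRotationInvariant σ) (e : E ≃ₗᵢ[ℝ] E)
    {g : E → ℝ} (hg : StronglyMeasurable g) : ∫ x, g (e x.1) ∂σ = ∫ x, g x.1 ∂σ := by
  have hme : Measurable (fun x : Metric.sphere (0 : E) 1 => e x.1) :=
    e.continuous.measurable.comp measurable_subtype_coe
  rw [← integral_map (φ := fun x : Metric.sphere (0 : E) 1 => e x.1) hme.aemeasurable
    hg.aestronglyMeasurable, h e,
    integral_map measurable_subtype_coe.aemeasurable hg.aestronglyMeasurable]

/-- The reflection in the hyperplane orthogonal to `u - w` exchanges two vectors of equal norm. -/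
theorem IsRotationInvariant.integral_inner_pow_eq [FiniteDimensional ℝ E]
    (h : IsRotationInvariant σ) (k : ℕ) {u w : E} (huw : ‖u‖ = ‖w‖) :
    ∫ x, ⟪u, x.1⟫ ^ k ∂σ = ∫ x, ⟪w, x.1⟫ ^ k ∂σ := by
  obtain ⟨e, he⟩ : ∃ e : E ≃ₗᵢ[ℝ] E, e u = w := ⟨_, Submodule.reflection_sub huw⟩
  rw [← h.integral_comp e (g := fun x => ⟪w, x⟫ ^ k) (by fun_prop)]
  congr 1
  ext x
  rw [← he, LinearIsometryEquiv.inner_map_map]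

theorem IsRotationInvariant.exists_integral_inner_pow [FiniteDimensional ℝ E] [Nontrivial E]
    (h : IsRotationInvariant σ) (k : ℕ) :
    ∃ c : ℝ, ∀ u : E, ∫ x, ⟪u, x.1⟫ ^ k ∂σ = c * ‖u‖ ^ k := by
  obtain ⟨e, he⟩ := exists_norm_eq E (zero_le_one (α := ℝ))
  refine ⟨∫ x, ⟪e, x.1⟫ ^ k ∂σ, fun u => ?_⟩
  rw [h.integral_inner_pow_eq k (u := u) (w := ‖u‖ • e) (by simp [norm_smul, he]),
    ← integral_mul_const]
  congr 1
  ext x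
  rw [real_inner_smul_left, mul_pow, mul_comm]

theorem integrable_of_continuous_of_compactSpace {X : Type*} [TopologicalSpace X]
    [CompactSpace X] [MeasurableSpace X] [OpensMeasurableSpace X] {μ : Measure X}
    [IsFiniteMeasure μ] {g : X → ℝ} (hg : Continuous g) : Integrable g μ :=
  hg.integrable_of_hasCompactSupport (HasCompactSupport.of_compactSpace g)

variable [FiniteDimensional ℝ E]

theorem IsRotationInvariant.exists_integral_inner_mul_inner [IsFiniteMeasure σ] [Nontrivial E]
    (h : IsRotationInvariant σ) :
    ∃ c : ℝ, ∀ u w : E, ∫ x, ⟪u, x.1⟫ * ⟪w, x.1⟫ ∂σ = c * ⟪u, w⟫ := by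
  obtain ⟨c, hc⟩ := h.exists_integral_inner_pow 2
  refine ⟨c, fun u w => ?_⟩
  have hi (v : E) : Integrable (fun x : Metric.sphere (0 : E) 1 => ⟪v, x.1⟫ ^ 2) σ :=
    integrable_of_continuous_of_compactSpace (by fun_prop)
  have key : ∀ x : Metric.sphere (0 : E) 1, ⟪u, x.1⟫ * ⟪w, x.1⟫ =
      4⁻¹ * (⟪u + w, x.1⟫ ^ 2 - ⟪u - w, x.1⟫ ^ 2) := fun x => by
    rw [inner_add_left, inner_sub_left]; ring
  simp_rw [key]
  rw [integral_const_mul, integral_sub (hi _) (hi _), hc, hc, norm_add_sq_real, norm_sub_sq_real]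
  ring

/-- Polarization of the fourth-power moment. On the diagonal the three pairings coincide, hence the
constant `c / 3`. -/
theorem IsRotationInvariant.exists_integral_inner_four [IsFiniteMeasure σ] [Nontrivial E]
    (h : IsRotationInvariant σ) :
    ∃ c : ℝ, ∀ a b u w : E, ∫ x, ⟪a, x.1⟫ * ⟪b, x.1⟫ * ⟪u, x.1⟫ * ⟪w, x.1⟫ ∂σ =
      c * (⟪a, b⟫ * ⟪u, w⟫ + ⟪a, u⟫ * ⟪b, w⟫ + ⟪a, w⟫ * ⟪b, u⟫) := by
  obtain ⟨c, hc⟩ := h.exists_integral_inner_pow 4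
  refine ⟨c / 3, fun a b u w => ?_⟩
  have hi (v : E) : Integrable (fun x : Metric.sphere (0 : E) 1 => ⟪v, x.1⟫ ^ 4) σ :=
    integrable_of_continuous_of_compactSpace (by fun_prop)
  -- Signed sum over the 8 sign patterns of `b`, `u`, `w`; only the mixed monomial survives, with
  -- coefficient 8 · 4! = 192.
  have key : ∀ x : Metric.sphere (0 : E) 1, ⟪a, x.1⟫ * ⟪b, x.1⟫ * ⟪u, x.1⟫ * ⟪w, x.1⟫ =
      192⁻¹ * (((⟪a + b + u + w, x.1⟫ ^ 4 + ⟪a + b - u - w, x.1⟫ ^ 4)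
        + (⟪a - b + u - w, x.1⟫ ^ 4 + ⟪a - b - u + w, x.1⟫ ^ 4))
        - ((⟪a + b + u - w, x.1⟫ ^ 4 + ⟪a + b - u + w, x.1⟫ ^ 4)
        + (⟪a - b + u + w, x.1⟫ ^ 4 + ⟪a - b - u - w, x.1⟫ ^ 4))) := fun x => by
    simp only [inner_add_left, inner_sub_left]; ring
  have hn : ∀ v : E, ‖v‖ ^ 4 = ⟪v, v⟫ ^ 2 := fun v => by
    rw [real_inner_self_eq_norm_sq]; ring
  simp_rw [key]
  have hi₂ (v v' : E) : Integrable (fun x : Metric.sphere (0 : E) 1 =>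
      ⟪v, x.1⟫ ^ 4 + ⟪v', x.1⟫ ^ 4) σ := (hi v).add (hi v')
  have hi₄ (v₁ v₂ v₃ v₄ : E) : Integrable (fun x : Metric.sphere (0 : E) 1 =>
      (⟪v₁, x.1⟫ ^ 4 + ⟪v₂, x.1⟫ ^ 4) + (⟪v₃, x.1⟫ ^ 4 + ⟪v₄, x.1⟫ ^ 4)) σ :=
    (hi₂ v₁ v₂).add (hi₂ v₃ v₄)
  rw [integral_const_mul, integral_sub (hi₄ _ _ _ _) (hi₄ _ _ _ _),
    integral_add (hi₂ _ _) (hi₂ _ _), integral_add (hi₂ _ _) (hi₂ _ _),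
    integral_add (hi _) (hi _), integral_add (hi _) (hi _), integral_add (hi _) (hi _),
    integral_add (hi _) (hi _)]
  simp only [hc, hn]
  simp only [inner_add_left, inner_sub_left, inner_add_right, inner_sub_right]
  rw [real_inner_comm a b, real_inner_comm a u, real_inner_comm a w, real_inner_comm b u,
    real_inner_comm b w, real_inner_comm u w]
  ring

theorem IsRotationInvariant.integral_inner_mul_inner [IsProbabilityMeasure σ] [Nontrivial E]
    (h : IsRotationInvariant σ) (u w : E) :
    ∫ x, ⟪u, x.1⟫ * ⟪w, x.1⟫ ∂σ = (Module.finrank ℝ E : ℝ)⁻¹ * ⟪u, w⟫ := by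
  obtain ⟨c, hc⟩ := h.exists_integral_inner_mul_inner
  rw [hc]
  congr 1
  have h1 : ∫ x, ∑ i, ⟪stdOrthonormalBasis ℝ E i, x.1⟫ * ⟪stdOrthonormalBasis ℝ E i, x.1⟫ ∂σ
      = 1 := by
    simp_rw [← pow_two, sum_inner_sq_eq_one]; simp
  rw [integral_finsetSum _ fun i _ => integrable_of_continuous_of_compactSpace (by fun_prop)] at h1
  simp only [hc, real_inner_self_eq_norm_sq, OrthonormalBasis.norm_eq_one] at h1
  simp only [one_pow, mul_one, Finset.sum_const, Finset.card_univ, Fintype.card_fin,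
    nsmul_eq_mul] at h1
  exact eq_inv_of_mul_eq_one_right h1

/-- Summing over pairs of basis vectors integrates `‖x‖⁴ = 1`; with `d` the dimension the pairings
contribute `d² + d + d`, which fixes the constant. -/
theorem IsRotationInvariant.integral_inner_four [IsProbabilityMeasure σ] [Nontrivial E]
    (h : IsRotationInvariant σ) (a b u w : E) :
    ∫ x, ⟪a, x.1⟫ * ⟪b, x.1⟫ * ⟪u, x.1⟫ * ⟪w, x.1⟫ ∂σ =
      ((Module.finrank ℝ E : ℝ) * (Module.finrank ℝ E + 2))⁻¹ *
        (⟪a, b⟫ * ⟪u, w⟫ + ⟪a, u⟫ * ⟪b, w⟫ + ⟪a, w⟫ * ⟪b, u⟫) := by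
  obtain ⟨c, hc⟩ := h.exists_integral_inner_four
  rw [hc]
  congr 1
  set e := stdOrthonormalBasis ℝ E with he
  have h1 : ∫ x, ∑ i, ∑ j, ⟪e i, x.1⟫ * ⟪e i, x.1⟫ * ⟪e j, x.1⟫ * ⟪e j, x.1⟫ ∂σ = 1 := by
    have : ∀ x : Metric.sphere (0 : E) 1,
        ∑ i, ∑ j, ⟪e i, x.1⟫ * ⟪e i, x.1⟫ * ⟪e j, x.1⟫ * ⟪e j, x.1⟫ = 1 := fun x => by
      simp_rw [mul_assoc, ← pow_two, ← mul_assoc, ← pow_two, ← Finset.mul_sum]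
      simp_rw [he, sum_inner_sq_eq_one, mul_one, sum_inner_sq_eq_one]
    simp_rw [this]; simp
  rw [integral_finsetSum _ fun i _ => integrable_of_continuous_of_compactSpace (by fun_prop)] at h1
  have h2 (i) : ∫ x, ∑ j, ⟪e i, x.1⟫ * ⟪e i, x.1⟫ * ⟪e j, x.1⟫ * ⟪e j, x.1⟫ ∂σ =
      ∑ j, ∫ x, ⟪e i, x.1⟫ * ⟪e i, x.1⟫ * ⟪e j, x.1⟫ * ⟪e j, x.1⟫ ∂σ :=
    integral_finsetSum _ fun j _ => integrable_of_continuous_of_compactSpace (by fun_prop)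
  simp_rw [h2] at h1
  simp only [hc, e.inner_eq_ite] at h1
  simp [Finset.sum_add_distrib, ← Finset.mul_sum] at h1
  refine eq_inv_of_mul_eq_one_right ?_
  linarith

end SphereMoments

/-! ### Algebra of the commutator as a linear map with Gram matrix. -/

section CommutatorSquare

open scoped RealInnerProductSpace

variable {n : ℕ}

/-- The squared Frobenius norm of the commutator of the matrices with entries `x`, `y`. -/
def commutatorSq (x y : EuclideanSpace ℝ (Fin n × Fin n)) : ℝ :=
  ∑ p : Fin n × Fin n, (∑ k, x (p.1, k) * y (k, p.2) - ∑ k, y (p.1, k) * x (k, p.2)) ^ 2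

/-- The vector whose inner product with `x` is the `p`-th entry of the commutator of `x`, `y`. -/
def commutatorRow (y : EuclideanSpace ℝ (Fin n × Fin n)) (p : Fin n × Fin n) :
    EuclideanSpace ℝ (Fin n × Fin n) :=
  WithLp.toLp 2 fun q => (if q.1 = p.1 then y (q.2, p.2) else 0) -
    (if q.2 = p.2 then y (p.1, q.1) else 0)

theorem inner_commutatorRow (x y : EuclideanSpace ℝ (Fin n × Fin n)) (p : Fin n × Fin n) :
    ⟪commutatorRow y p, x⟫ = ∑ k, x (p.1, k) * y (k, p.2) - ∑ k, y (p.1, k) * x (k, p.2) := by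
  simp only [PiLp.inner_apply, commutatorRow, RCLike.inner_apply, conj_trivial, mul_sub,
    Finset.sum_sub_distrib, Fintype.sum_prod_type]
  congr 1
  · rw [Finset.sum_comm]; simp
  · simp [mul_comm]

theorem inner_commutatorRow_commutatorRow (y : EuclideanSpace ℝ (Fin n × Fin n))
    (p q : Fin n × Fin n) :
    ⟪commutatorRow y p, commutatorRow y q⟫ =
      (if p.1 = q.1 then ∑ j, y (j, p.2) * y (j, q.2) else 0) +
      (if p.2 = q.2 then ∑ j, y (p.1, j) * y (q.1, j) else 0) -
      y (q.2, p.2) * y (q.1, p.1) - y (p.1, q.1) * y (p.2, q.2) := by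
  rw [inner_commutatorRow]
  simp only [commutatorRow, sub_mul, mul_sub, ite_mul, mul_ite, zero_mul, mul_zero,
    Finset.sum_sub_distrib]
  have h1 : ∑ k, (if p.1 = q.1 then y (k, q.2) * y (k, p.2) else 0) =
      if p.1 = q.1 then ∑ j, y (j, p.2) * y (j, q.2) else 0 := by
    split_ifs <;> simp [mul_comm]
  have h2 : ∑ k, (if p.2 = q.2 then y (p.1, k) * y (q.1, k) else 0) =
      if p.2 = q.2 then ∑ j, y (p.1, j) * y (q.1, j) else 0 := by
    split_ifs <;> simp
  rw [h1, h2]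
  simp
  ring

/-- This trace of the quadratic form `x ↦ ‖xy - yx‖²` determines its mean on the sphere. -/
theorem sum_inner_commutatorRow_self (y : EuclideanSpace ℝ (Fin n × Fin n)) :
    ∑ p, ⟪commutatorRow y p, commutatorRow y p⟫ =
      2 * n * ‖y‖ ^ 2 - 2 * (∑ i, y (i, i)) ^ 2 := by
  simp only [inner_commutatorRow_commutatorRow, if_true, Finset.sum_sub_distrib,
    Finset.sum_add_distrib, Fintype.sum_prod_type, EuclideanSpace.norm_sq_eq, Real.norm_eq_abs,
    sq_abs, Finset.sum_const, Finset.card_univ, Fintype.card_fin, nsmul_eq_mul]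
  have h : ∑ i, ∑ j, y (i, i) * y (j, j) = (∑ i, y (i, i)) ^ 2 := by
    rw [pow_two, Finset.sum_mul_sum]
  have h' : ∑ i, ∑ j, y (j, j) * y (i, i) = (∑ i, y (i, i)) ^ 2 := by
    rw [Finset.sum_comm, h]
  rw [h, h', Finset.sum_comm (f := fun i j => y (j, i) * y (j, i))]
  simp only [← pow_two, ← Finset.mul_sum]
  ring

/-- Sum of the squared entries of the Gram matrices of the rows and of the columns of `y`. -/
def gramSq (y : EuclideanSpace ℝ (Fin n × Fin n)) : ℝ :=
  ∑ i, ∑ j, (∑ k, y (i, k) * y (j, k)) ^ 2 + ∑ i, ∑ j, (∑ k, y (k, i) * y (k, j)) ^ 2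

/-- Controls the variance. Each Gram entry has four terms, separated by Cauchy–Schwarz at the cost
of a factor 4. The two terms with a Kronecker delta give `n * gramSq y`, the other two `‖y‖ ^ 4`
each. -/
theorem sum_inner_commutatorRow_sq_le (y : EuclideanSpace ℝ (Fin n × Fin n)) :
    ∑ p, ∑ q, ⟪commutatorRow y p, commutatorRow y q⟫ ^ 2 ≤
      4 * (n * gramSq y + 2 * ‖y‖ ^ 4) := by
  have h4 (a b c d : ℝ) : (a + b - c - d) ^ 2 ≤ 4 * (a ^ 2 + b ^ 2 + c ^ 2 + d ^ 2) := by
    nlinarith [sq_nonneg (a - b), sq_nonneg (a + c), sq_nonneg (a + d), sq_nonneg (b + c),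
      sq_nonneg (b + d), sq_nonneg (c - d)]
  calc
    _ ≤ ∑ p : Fin n × Fin n, ∑ q : Fin n × Fin n,
      4 * ((if p.1 = q.1 then ∑ j, y (j, p.2) * y (j, q.2) else 0) ^ 2 +
      (if p.2 = q.2 then ∑ j, y (p.1, j) * y (q.1, j) else 0) ^ 2 +
      (y (q.2, p.2) * y (q.1, p.1)) ^ 2 + (y (p.1, q.1) * y (p.2, q.2)) ^ 2) := by
        refine Finset.sum_le_sum fun p _ => Finset.sum_le_sum fun q _ => ?_
        rw [inner_commutatorRow_commutatorRow]
        exact h4 _ _ _ _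
    _ = _ := by
      have hn : ‖y‖ ^ 4 = (∑ i, ∑ j, y (i, j) ^ 2) * (∑ i, ∑ j, y (i, j) ^ 2) := by
        rw [← Fintype.sum_prod_type (f := fun p => y p ^ 2),
          show (4 : ℕ) = 2 * 2 from rfl, pow_mul, EuclideanSpace.norm_sq_eq]
        simp [pow_two]
      have h1 : ∑ p : Fin n × Fin n, ∑ q : Fin n × Fin n, (y (p.1, q.1) * y (p.2, q.2)) ^ 2 =
          ‖y‖ ^ 4 := by
        rw [hn]
        simp only [Fintype.sum_prod_type, mul_pow, ← Finset.sum_mul_sum]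
      have h2 : ∑ p : Fin n × Fin n, ∑ q : Fin n × Fin n, (y (q.2, p.2) * y (q.1, p.1)) ^ 2 =
          ‖y‖ ^ 4 := by
        rw [Finset.sum_comm, ← h1]
        simp only [mul_comm]
      have h3 : ∑ p : Fin n × Fin n, ∑ q : Fin n × Fin n,
          (if p.1 = q.1 then ∑ j, y (j, p.2) * y (j, q.2) else 0) ^ 2 =
          n * ∑ i, ∑ j, (∑ k, y (k, i) * y (k, j)) ^ 2 := by
        simp only [Fintype.sum_prod_type, ite_pow, ne_eq, OfNat.ofNat_ne_zero, not_false_eq_true,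
          zero_pow]
        simp
      have h5 : ∑ p : Fin n × Fin n, ∑ q : Fin n × Fin n,
          (if p.2 = q.2 then ∑ j, y (p.1, j) * y (q.1, j) else 0) ^ 2 =
          n * ∑ i, ∑ j, (∑ k, y (i, k) * y (j, k)) ^ 2 := by
        simp only [Fintype.sum_prod_type, ite_pow, ne_eq, OfNat.ofNat_ne_zero, not_false_eq_true,
          zero_pow, Finset.sum_ite_eq, Finset.mem_univ, if_true]
        simp [Finset.mul_sum]
      simp only [← Finset.mul_sum, Finset.sum_add_distrib, h1, h2, h3, h5, gramSq]
      ring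

end CommutatorSquare

/-! ### Moments of the squared commutator norm and Chebyshev's inequality. -/

section CommutatorMoments

open scoped RealInnerProductSpace

theorem IsRotationInvariant.integral_coord_four {ι : Type*} [Fintype ι] [DecidableEq ι]
    [Nonempty ι] {σ : Measure (Metric.sphere (0 : EuclideanSpace ℝ ι) 1)} [IsProbabilityMeasure σ]
    (h : IsRotationInvariant σ) (p q r s : ι) :
    ∫ x, x.1 p * x.1 q * x.1 r * x.1 s ∂σ =
      ((Fintype.card ι : ℝ) * (Fintype.card ι + 2))⁻¹ *
        ((if p = q then 1 else 0) * (if r = s then 1 else 0) +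
         (if p = r then 1 else 0) * (if q = s then 1 else 0) +
         (if p = s then 1 else 0) * (if q = r then 1 else 0)) := by
  have := h.integral_inner_four (EuclideanSpace.single p 1) (EuclideanSpace.single q 1)
    (EuclideanSpace.single r 1) (EuclideanSpace.single s 1)
  simpa [EuclideanSpace.inner_single_left, Pi.single_apply, ← ite_and, and_comm] using this

variable {n : ℕ}

theorem commutatorSq_eq_sum_inner_sq (x y : EuclideanSpace ℝ (Fin n × Fin n)) :
    commutatorSq x y = ∑ p, ⟪commutatorRow y p, x⟫ ^ 2 := by
  simp only [commutatorSq, inner_commutatorRow]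

theorem continuous_commutatorSq :
    Continuous fun z : EuclideanSpace ℝ (Fin n × Fin n) × EuclideanSpace ℝ (Fin n × Fin n) =>
      commutatorSq z.1 z.2 := by
  unfold commutatorSq
  fun_prop

theorem continuous_gramSq : Continuous (gramSq (n := n)) := by
  unfold gramSq
  fun_prop

variable [NeZero n]
  {σ : Measure (Metric.sphere (0 : EuclideanSpace ℝ (Fin n × Fin n)) 1)} [IsProbabilityMeasure σ]

theorem integral_commutatorSq (h : IsRotationInvariant σ)
    (y : EuclideanSpace ℝ (Fin n × Fin n)) :
    ∫ x, commutatorSq x.1 y ∂σ =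
      ((n : ℝ) ^ 2)⁻¹ * ∑ p, ⟪commutatorRow y p, commutatorRow y p⟫ := by
  simp_rw [commutatorSq_eq_sum_inner_sq]
  rw [integral_finsetSum _ fun i _ => integrable_of_continuous_of_compactSpace (by fun_prop),
    Finset.mul_sum]
  refine Finset.sum_congr rfl fun p _ => ?_
  simp_rw [pow_two ⟪_, _⟫, h.integral_inner_mul_inner]
  simp [pow_two]

theorem integral_commutatorSq_sq (h : IsRotationInvariant σ)
    (y : EuclideanSpace ℝ (Fin n × Fin n)) :
    ∫ x, commutatorSq x.1 y ^ 2 ∂σ =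
      ((n : ℝ) ^ 2 * ((n : ℝ) ^ 2 + 2))⁻¹ *
        ((∑ p, ⟪commutatorRow y p, commutatorRow y p⟫) ^ 2 +
          2 * ∑ p, ∑ q, ⟪commutatorRow y p, commutatorRow y q⟫ ^ 2) := by
  simp_rw [commutatorSq_eq_sum_inner_sq, pow_two (∑ p, _), Finset.sum_mul_sum]
  rw [integral_finsetSum _ fun i _ => integrable_of_continuous_of_compactSpace (by fun_prop)]
  have h2 (p) : ∫ x, ∑ q, ⟪commutatorRow y p, x.1⟫ ^ 2 * ⟪commutatorRow y q, x.1⟫ ^ 2 ∂σ =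
      ∑ q, ∫ x, ⟪commutatorRow y p, x.1⟫ ^ 2 * ⟪commutatorRow y q, x.1⟫ ^ 2 ∂σ :=
    integral_finsetSum _ fun j _ => integrable_of_continuous_of_compactSpace (by fun_prop)
  have h3 (p q) : ∫ x, ⟪commutatorRow y p, x.1⟫ ^ 2 * ⟪commutatorRow y q, x.1⟫ ^ 2 ∂σ =
      ((n : ℝ) ^ 2 * ((n : ℝ) ^ 2 + 2))⁻¹ *
      (⟪commutatorRow y p, commutatorRow y p⟫ * ⟪commutatorRow y q, commutatorRow y q⟫ +
        2 * ⟪commutatorRow y p, commutatorRow y q⟫ ^ 2) := by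
    have := h.integral_inner_four (commutatorRow y p) (commutatorRow y p) (commutatorRow y q)
      (commutatorRow y q)
    simp only [finrank_euclideanSpace, Fintype.card_prod, Fintype.card_fin, Nat.cast_mul] at this
    simp_rw [pow_two, ← mul_assoc] at this ⊢
    rw [this]
    ring
  simp_rw [h2, h3, ← Finset.mul_sum, Finset.sum_add_distrib, ← Finset.mul_sum]

/-- The indexing `φ` treats rows and columns at once. Of the three pairings, two leave three free
indices (`n³` each) and the third leaves two (`n²`). -/
theorem integral_sum_gram_sq (h : IsRotationInvariant σ) (φ : Fin n → Fin n → Fin n × Fin n)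
    (hφ : ∀ i j k l, φ i k = φ j l ↔ i = j ∧ k = l) :
    ∫ y, ∑ i, ∑ j, (∑ k, y.1 (φ i k) * y.1 (φ j k)) ^ 2 ∂σ =
      ((n : ℝ) ^ 2 * ((n : ℝ) ^ 2 + 2))⁻¹ * (2 * (n : ℝ) ^ 3 + (n : ℝ) ^ 2) := by
  have e (y : Metric.sphere (0 : EuclideanSpace ℝ (Fin n × Fin n)) 1) :
      ∑ i, ∑ j, (∑ k, y.1 (φ i k) * y.1 (φ j k)) ^ 2 = ∑ z : (Fin n × Fin n) × (Fin n × Fin n),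
        y.1 (φ z.1.1 z.2.1) * y.1 (φ z.1.2 z.2.1) * y.1 (φ z.1.1 z.2.2) * y.1 (φ z.1.2 z.2.2) := by
    simp only [Fintype.sum_prod_type, pow_two, Finset.sum_mul_sum, mul_assoc]
  simp_rw [e]
  rw [integral_finsetSum _ fun i _ => integrable_of_continuous_of_compactSpace (by fun_prop)]
  simp_rw [h.integral_coord_four, ← Finset.mul_sum, Fintype.sum_prod_type, hφ]
  have e₁ : ∑ i : Fin n, ∑ j : Fin n, ∑ k : Fin n, ∑ l : Fin n,
      (if i = j ∧ k = l then (1 : ℝ) else 0) * (if j = i ∧ k = l then 1 else 0) = (n : ℝ) ^ 2 := by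
    simp only [eq_comm (b := (_ : Fin n)), ite_and]
    simp [pow_two]
  simp_rw [Finset.sum_add_distrib, e₁]
  simp
  ring

theorem integral_gramSq_le (h : IsRotationInvariant σ) : ∫ y, gramSq y.1 ∂σ ≤ 6 / (n : ℝ) := by
  unfold gramSq
  rw [integral_add (integrable_of_continuous_of_compactSpace (by fun_prop))
    (integrable_of_continuous_of_compactSpace (by fun_prop)),
    integral_sum_gram_sq h (fun i k => (i, k)) (by simp),
    integral_sum_gram_sq h (fun i k => (k, i)) (by simp [and_comm])]
  have hn : (1 : ℝ) ≤ n := by exact_mod_cast NeZero.one_le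
  rw [← mul_add, inv_mul_eq_div, div_le_div_iff₀ (by positivity) (by positivity)]
  nlinarith [pow_pos (show (0 : ℝ) < n by linarith) 2, pow_pos (show (0 : ℝ) < n by linarith) 3,
    pow_le_pow_right₀ hn (show 3 ≤ 4 by norm_num)]

/-- The trace is the inner product with the identity, of squared norm `n`. The crude constant
suffices, since it is later divided by `n²`. -/
theorem integral_trace_pow_four_le (h : IsRotationInvariant σ) :
    ∫ y, (∑ i, y.1 (i, i)) ^ 4 ∂σ ≤ 3 := by
  set u : EuclideanSpace ℝ (Fin n × Fin n) := ∑ i, EuclideanSpace.single (i, i) 1 with hu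
  have hu' (y : EuclideanSpace ℝ (Fin n × Fin n)) : ⟪u, y⟫ = ∑ i, y (i, i) := by
    simp [hu, sum_inner, EuclideanSpace.inner_single_left]
  have huu : ⟪u, u⟫ = (n : ℝ) := by
    rw [hu', hu]; simp [Pi.single_apply]
  have := h.integral_inner_four u u u u
  simp only [huu, hu', finrank_euclideanSpace, Fintype.card_prod, Fintype.card_fin,
    Nat.cast_mul] at this
  have hn : (1 : ℝ) ≤ n := by exact_mod_cast NeZero.one_le
  have e (y : Metric.sphere (0 : EuclideanSpace ℝ (Fin n × Fin n)) 1) :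
      (∑ i, y.1 (i, i)) ^ 4 = (∑ i, y.1 (i, i)) * (∑ i, y.1 (i, i)) * (∑ i, y.1 (i, i)) *
        (∑ i, y.1 (i, i)) := by ring
  simp_rw [e]
  rw [this, inv_mul_eq_div, div_le_iff₀ (by positivity)]
  nlinarith [mul_self_nonneg ((n : ℝ) * n), mul_self_nonneg (n : ℝ)]

/-- The left side is the expanded second moment of the deviation, with `r = n`, `t` the trace and
`G` the sum of squared Gram entries. Weakening `r² + 2` to `r²` completes a square, leaving only
`4t⁴ / r²` besides the `G` term. -/
theorem quadratic_deviation_le {r G : ℝ} (hr : 0 < r) (hG : 0 ≤ G) (t : ℝ) :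
    r ^ 2 * ((r ^ 2 * (r ^ 2 + 2))⁻¹ * ((2 * r - 2 * t ^ 2) ^ 2 + 2 * G)) -
      4 * r * ((r ^ 2)⁻¹ * (2 * r - 2 * t ^ 2)) + 4 ≤ (4 * t ^ 4 + 2 * G) / r ^ 2 := by
  have hm : (r ^ 2 * (r ^ 2 + 2))⁻¹ ≤ (r ^ 4)⁻¹ := by
    gcongr
    nlinarith [sq_nonneg r]
  calc _ ≤ r ^ 2 * ((r ^ 4)⁻¹ * ((2 * r - 2 * t ^ 2) ^ 2 + 2 * G)) -
        4 * r * ((r ^ 2)⁻¹ * (2 * r - 2 * t ^ 2)) + 4 := by gcongr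
    _ = _ := by field_simp; ring

theorem integral_sub_sq_le_of_norm_eq_one (h : IsRotationInvariant σ)
    {y : EuclideanSpace ℝ (Fin n × Fin n)} (hy : ‖y‖ = 1) :
    ∫ x, ((n : ℝ) * commutatorSq x.1 y - 2) ^ 2 ∂σ ≤
      (4 * (∑ i, y (i, i)) ^ 4 + 8 * (n * gramSq y + 2)) / (n : ℝ) ^ 2 := by
  have hn : (0 : ℝ) < n := by exact_mod_cast NeZero.pos n
  have hc : Continuous fun x : Metric.sphere (0 : EuclideanSpace ℝ (Fin n × Fin n)) 1 =>
      commutatorSq x.1 y := by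
    unfold commutatorSq
    fun_prop
  have e (x : Metric.sphere (0 : EuclideanSpace ℝ (Fin n × Fin n)) 1) :
      ((n : ℝ) * commutatorSq x.1 y - 2) ^ 2 =
        (n ^ 2 * commutatorSq x.1 y ^ 2 - 4 * n * commutatorSq x.1 y) + 4 := by ring
  have hi₁ : Integrable (fun x : Metric.sphere (0 : EuclideanSpace ℝ (Fin n × Fin n)) 1 =>
      (n : ℝ) ^ 2 * commutatorSq x.1 y ^ 2) σ :=
    integrable_of_continuous_of_compactSpace (continuous_const.mul (hc.pow 2))
  have hi₂ : Integrable (fun x : Metric.sphere (0 : EuclideanSpace ℝ (Fin n × Fin n)) 1 =>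
      4 * (n : ℝ) * commutatorSq x.1 y) σ :=
    integrable_of_continuous_of_compactSpace (continuous_const.mul hc)
  have hi₃ : Integrable (fun x : Metric.sphere (0 : EuclideanSpace ℝ (Fin n × Fin n)) 1 =>
      (n : ℝ) ^ 2 * commutatorSq x.1 y ^ 2 - 4 * (n : ℝ) * commutatorSq x.1 y) σ := hi₁.sub hi₂
  rw [integral_congr_ae (ae_of_all _ e), integral_add hi₃ (integrable_const _),
    integral_sub hi₁ hi₂, integral_const_mul, integral_const_mul, integral_commutatorSq h,
    integral_commutatorSq_sq h]
  have hG := sum_inner_commutatorRow_sq_le y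
  have hG0 : 0 ≤ ∑ p, ∑ q, ⟪commutatorRow y p, commutatorRow y q⟫ ^ 2 :=
    Finset.sum_nonneg fun _ _ => Finset.sum_nonneg fun _ _ => sq_nonneg _
  rw [sum_inner_commutatorRow_self, hy, integral_const, probReal_univ, one_smul]
  rw [hy] at hG
  simp only [one_pow, mul_one] at hG ⊢
  refine (quadratic_deviation_le hn hG0 _).trans ?_
  exact div_le_div_of_nonneg_right (by linarith) (by positivity)

/-- The second moment of the deviation of `n * ‖X * Y - Y * X‖ ^ 2` from `2`. -/
theorem integral_integral_sub_sq_le (h : IsRotationInvariant σ) :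
    ∫ y, ∫ x, ((n : ℝ) * commutatorSq x.1 y.1 - 2) ^ 2 ∂σ ∂σ ≤ 76 / (n : ℝ) ^ 2 := by
  have hn : (0 : ℝ) < n := by exact_mod_cast NeZero.pos n
  have hg : Continuous fun y : Metric.sphere (0 : EuclideanSpace ℝ (Fin n × Fin n)) 1 =>
      gramSq y.1 := continuous_gramSq.comp continuous_subtype_val
  have hi₁ : Integrable (fun y : Metric.sphere (0 : EuclideanSpace ℝ (Fin n × Fin n)) 1 =>
      (∑ i, y.1 (i, i)) ^ 4) σ := integrable_of_continuous_of_compactSpace (by fun_prop)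
  have hi₂ : Integrable (fun y : Metric.sphere (0 : EuclideanSpace ℝ (Fin n × Fin n)) 1 =>
      gramSq y.1) σ := integrable_of_continuous_of_compactSpace hg
  have hi₃ : Integrable (fun y : Metric.sphere (0 : EuclideanSpace ℝ (Fin n × Fin n)) 1 =>
      n * gramSq y.1 + 2) σ := (hi₂.const_mul _).add (integrable_const _)
  calc _ ≤ ∫ y, (4 * (∑ i, y.1 (i, i)) ^ 4 + 8 * (n * gramSq y.1 + 2)) / (n : ℝ) ^ 2 ∂σ := by
        refine integral_mono_of_nonneg
          (ae_of_all _ fun y => integral_nonneg fun x => sq_nonneg _)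
          (integrable_of_continuous_of_compactSpace (by fun_prop))
          (ae_of_all _ fun y => integral_sub_sq_le_of_norm_eq_one h (by simp))
    _ = (4 * ∫ y, (∑ i, y.1 (i, i)) ^ 4 ∂σ + 8 * (n * ∫ y, gramSq y.1 ∂σ + 2)) / (n : ℝ) ^ 2 := by
        rw [integral_div, integral_add (hi₁.const_mul _)
          (hi₃.const_mul _), integral_const_mul,
          integral_const_mul, integral_add (hi₂.const_mul _) (integrable_const _),
          integral_const_mul]
        simp
    _ ≤ (4 * 3 + 8 * (n * (6 / (n : ℝ)) + 2)) / (n : ℝ) ^ 2 := by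
        gcongr
        · exact integral_trace_pow_four_le h
        · exact integral_gramSq_le h
    _ = 76 / (n : ℝ) ^ 2 := by
        field_simp; norm_num

theorem measureReal_prod_le_of_isRotationInvariant (h : IsRotationInvariant σ) :
    (σ.prod σ).real {z | 2 / 3 ≤ |n * commutatorSq z.1.1 z.2.1 - 2|} ≤ 171 / (n : ℝ) ^ 2 := by
  have hc : Continuous fun z : Metric.sphere (0 : EuclideanSpace ℝ (Fin n × Fin n)) 1 ×
      Metric.sphere (0 : EuclideanSpace ℝ (Fin n × Fin n)) 1 =>
      (n * commutatorSq z.1.1 z.2.1 - 2) ^ 2 := by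
    have := continuous_commutatorSq.comp
      ((continuous_subtype_val (p := (· ∈ Metric.sphere (0 : EuclideanSpace ℝ (Fin n × Fin n)) 1))
        ).prodMap (continuous_subtype_val
          (p := (· ∈ Metric.sphere (0 : EuclideanSpace ℝ (Fin n × Fin n)) 1))))
    simp only [Function.comp_def, Prod.map] at this
    fun_prop
  have hi : Integrable (fun z : Metric.sphere (0 : EuclideanSpace ℝ (Fin n × Fin n)) 1 ×
      Metric.sphere (0 : EuclideanSpace ℝ (Fin n × Fin n)) 1 =>
      (n * commutatorSq z.1.1 z.2.1 - 2) ^ 2) (σ.prod σ) :=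
    integrable_of_continuous_of_compactSpace hc
  have hM := mul_meas_ge_le_integral_of_nonneg (ae_of_all _ fun z => sq_nonneg _) hi (4 / 9)
  -- The inner integral must run over the first matrix, with the second one fixed.
  rw [integral_prod_symm _ hi] at hM
  have hs : {z : Metric.sphere (0 : EuclideanSpace ℝ (Fin n × Fin n)) 1 ×
      Metric.sphere (0 : EuclideanSpace ℝ (Fin n × Fin n)) 1 |
        2 / 3 ≤ |n * commutatorSq z.1.1 z.2.1 - 2|} =
      {z | 4 / 9 ≤ (n * commutatorSq z.1.1 z.2.1 - 2) ^ 2} := by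
    ext z
    simp only [Set.mem_ofPred_eq]
    rw [← sq_abs (_ - _), show (4 / 9 : ℝ) = (2 / 3) ^ 2 by norm_num]
    exact (pow_le_pow_iff_left₀ (by norm_num) (abs_nonneg _) two_ne_zero).symm
  rw [hs]
  have := hM.trans (integral_integral_sub_sq_le h)
  rw [show 171 / (n : ℝ) ^ 2 = 9 / 4 * (76 / (n : ℝ) ^ 2) by ring]
  linarith

end CommutatorMoments

/-! ### Transfer to random matrices and the union bound. -/

section UniformUnitMatrix

theorem isProbabilityMeasure_uniformOnUnitSphere (n : ℕ) [NeZero n] :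
    IsProbabilityMeasure (uniformOnUnitSphere n) := by
  constructor
  rw [uniformOnUnitSphere, Measure.smul_apply, smul_eq_mul]
  exact ENNReal.inv_mul_cancel (Measure.measure_univ_ne_zero.2 (Measure.toSphere_ne_zero _))
    (measure_ne_top _ _)

theorem isRotationInvariant_uniformOnUnitSphere (n : ℕ) :
    IsRotationInvariant (uniformOnUnitSphere n) :=
  isRotationInvariant_toSphere.smul _

variable {n : ℕ}

theorem measurable_matrix_entry (i j : Fin n) :
    Measurable fun X : Matrix (Fin n) (Fin n) ℝ => X i j :=
  (measurable_pi_apply j).comp (measurable_pi_apply (X := fun _ => Fin n → ℝ) i)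

theorem measurable_sphere_toMatrix : Measurable
    fun x : Metric.sphere (0 : EuclideanSpace ℝ (Fin n × Fin n)) 1 =>
      (Matrix.of fun i j => x.1 (i, j) : Matrix (Fin n) (Fin n) ℝ) :=
  measurable_pi_lambda (X := fun _ => Fin n → ℝ) _ fun i => measurable_pi_lambda _ fun j => by
    change Measurable fun x : Metric.sphere (0 : EuclideanSpace ℝ (Fin n × Fin n)) 1 => x.1 (i, j)
    have : Continuous fun x : Metric.sphere (0 : EuclideanSpace ℝ (Fin n × Fin n)) 1 =>
      x.1 (i, j) := by fun_prop
    exact this.measurable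

theorem commutatorDist_two (X Y : Matrix (Fin n) (Fin n) ℝ) :
    commutatorDist 2 X Y = ∑ p : Fin n × Fin n,
      (∑ k, X p.1 k * Y k p.2 - ∑ k, Y p.1 k * X k p.2) ^ 2 := by
  rw [commutatorDist, Matrix.frobenius_norm_def, ← Real.rpow_mul (by positivity)]
  norm_num
  simp [Fintype.sum_prod_type, Matrix.mul_apply]

theorem commutatorDist_one_nonneg (X Y : Matrix (Fin n) (Fin n) ℝ) : 0 ≤ commutatorDist 1 X Y := by
  rw [commutatorDist, Matrix.frobenius_norm_def]
  positivity

theorem commutatorDist_one_sq (X Y : Matrix (Fin n) (Fin n) ℝ) :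
    commutatorDist 1 X Y ^ 2 = commutatorDist 2 X Y := by
  simp [commutatorDist]

theorem measurable_commutatorDist_two : Measurable
    fun Z : Matrix (Fin n) (Fin n) ℝ × Matrix (Fin n) (Fin n) ℝ => commutatorDist 2 Z.1 Z.2 := by
  simp_rw [commutatorDist_two]
  have h₁ (i j : Fin n) : Measurable fun Z : Matrix (Fin n) (Fin n) ℝ × Matrix (Fin n) (Fin n) ℝ =>
    Z.1 i j := (measurable_matrix_entry i j).comp measurable_fst
  have h₂ (i j : Fin n) : Measurable fun Z : Matrix (Fin n) (Fin n) ℝ × Matrix (Fin n) (Fin n) ℝ =>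
    Z.2 i j := (measurable_matrix_entry i j).comp measurable_snd
  fun_prop

theorem measureReal_commutatorDist_deviation_le [NeZero n] {Ω : Type*} [MeasurableSpace Ω]
    {P : Measure Ω} [IsProbabilityMeasure P] {X Y : Ω → Matrix (Fin n) (Fin n) ℝ}
    (hX : HasLaw X (uniformUnitMatrix n) P) (hY : HasLaw Y (uniformUnitMatrix n) P)
    (hXY : IndepFun X Y P) :
    P.real {ω | 2 / 3 ≤ |n * commutatorDist 2 (X ω) (Y ω) - 2|} ≤ 171 / (n : ℝ) ^ 2 := by
  have := isProbabilityMeasure_uniformOnUnitSphere n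
  have hlaw : HasLaw (fun ω => (X ω, Y ω))
      (((uniformOnUnitSphere n).prod (uniformOnUnitSphere n)).map
        (Prod.map (fun x => Matrix.of fun i j => x.1 (i, j))
          (fun x => Matrix.of fun i j => x.1 (i, j)))) P := by
    refine ⟨hX.aemeasurable.prodMk hY.aemeasurable, ?_⟩
    rw [hXY.map_prod_eq_prod_map_map hX.aemeasurable hY.aemeasurable, hX.map_eq, hY.map_eq,
      uniformUnitMatrix, Measure.map_prod_map _ _ measurable_sphere_toMatrix
        measurable_sphere_toMatrix]
  have hs : MeasurableSet {Z : Matrix (Fin n) (Fin n) ℝ × Matrix (Fin n) (Fin n) ℝ |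
      2 / 3 ≤ |n * commutatorDist 2 Z.1 Z.2 - 2|} := by
    have := measurable_commutatorDist_two (n := n)
    refine measurableSet_le measurable_const ?_
    exact ((this.const_mul _).sub_const _).abs
  rw [hlaw.measureReal_eq hs, map_measureReal_apply
    (measurable_sphere_toMatrix.prodMap measurable_sphere_toMatrix) hs]
  refine le_of_eq_of_le ?_
    (measureReal_prod_le_of_isRotationInvariant (isRotationInvariant_uniformOnUnitSphere n))
  congr 1
  ext z
  simp [commutatorDist_two, commutatorSq]

/-- Reduces `α = 1` to `α = 2`: for nonnegative reals, `a + b < c` gives `a² + b² ≤ (a + b)² < c²`.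
-/
theorem commutatorDist_two_lt_of_triangleDefect_neg {α : ℝ} (hα : α = 1 ∨ α = 2)
    {A B C : Matrix (Fin n) (Fin n) ℝ} (h : triangleDefect α A B C < 0) :
    commutatorDist 2 A B + commutatorDist 2 B C < commutatorDist 2 A C := by
  unfold triangleDefect at h
  obtain rfl | rfl := hα
  · rw [← commutatorDist_one_sq, ← commutatorDist_one_sq, ← commutatorDist_one_sq]
    nlinarith [commutatorDist_one_nonneg A B, commutatorDist_one_nonneg B C,
      commutatorDist_one_nonneg A C,
      mul_nonneg (commutatorDist_one_nonneg A B) (commutatorDist_one_nonneg B C)]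
  · linarith

theorem measureReal_triangleDefect_neg_le [NeZero n] {Ω : Type*} [MeasurableSpace Ω]
    {P : Measure Ω} [IsProbabilityMeasure P] {A B C : Ω → Matrix (Fin n) (Fin n) ℝ}
    (hA : HasLaw A (uniformUnitMatrix n) P) (hB : HasLaw B (uniformUnitMatrix n) P)
    (hC : HasLaw C (uniformUnitMatrix n) P) (hind : iIndepFun ![A, B, C] P)
    {α : ℝ} (hα : α = 1 ∨ α = 2) :
    P.real {ω | triangleDefect α (A ω) (B ω) (C ω) < 0} ≤ 513 / (n : ℝ) ^ 2 := by
  have hAB : IndepFun A B P := hind.indepFun (i := 0) (j := 1) (by decide)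
  have hBC : IndepFun B C P := hind.indepFun (i := 1) (j := 2) (by decide)
  have hAC : IndepFun A C P := hind.indepFun (i := 0) (j := 2) (by decide)
  have hn : (0 : ℝ) ≤ n := n.cast_nonneg
  have hsub : {ω | triangleDefect α (A ω) (B ω) (C ω) < 0} ⊆
      {ω | 2 / 3 ≤ |n * commutatorDist 2 (A ω) (B ω) - 2|} ∪
      {ω | 2 / 3 ≤ |n * commutatorDist 2 (B ω) (C ω) - 2|} ∪
      {ω | 2 / 3 ≤ |n * commutatorDist 2 (A ω) (C ω) - 2|} := by
    intro ω hω
    have hlt := commutatorDist_two_lt_of_triangleDefect_neg hα hω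
    by_contra hcon
    simp only [Set.mem_union, Set.mem_ofPred_eq, not_or, not_le, abs_lt] at hcon
    obtain ⟨⟨h₁, h₂⟩, h₃⟩ := hcon
    -- The threshold 2/3 is the largest possible here: `2 (2 - 2/3) = 2 + 2/3`.
    nlinarith [mul_le_mul_of_nonneg_left hlt.le hn]
  calc _ ≤ _ := measureReal_mono hsub
    _ ≤ _ := (measureReal_union_le _ _).trans (add_le_add_left (measureReal_union_le _ _) _)
    _ ≤ 171 / (n : ℝ) ^ 2 + 171 / (n : ℝ) ^ 2 + 171 / (n : ℝ) ^ 2 :=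
      add_le_add (add_le_add (measureReal_commutatorDist_deviation_le hA hB hAB)
        (measureReal_commutatorDist_deviation_le hB hC hBC))
        (measureReal_commutatorDist_deviation_le hA hC hAC)
    _ = _ := by ring

end UniformUnitMatrix

theorem theorem3p1 (Ω : ℕ → Type*) [∀ n, MeasurableSpace (Ω n)]
    (P : ∀ n, Measure (Ω n)) [∀ n, IsProbabilityMeasure (P n)]
    (A B C : ∀ n, Ω n → Matrix (Fin n) (Fin n) ℝ)
    (hA : ∀ n, 2 ≤ n → HasLaw (A n) (uniformUnitMatrix n) (P n))
    (hB : ∀ n, 2 ≤ n → HasLaw (B n) (uniformUnitMatrix n) (P n))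
    (hC : ∀ n, 2 ≤ n → HasLaw (C n) (uniformUnitMatrix n) (P n))
    (hind : ∀ n, 2 ≤ n → iIndepFun ![A n, B n, C n] (P n))
    (α : ℝ) (hα : α = 1 ∨ α = 2) :
    Tendsto (fun n => (P n).real {ω | triangleDefect α (A n ω) (B n ω) (C n ω) < 0})
        atTop (𝓝 0) ∧
      (fun n => (P n).real {ω | triangleDefect α (A n ω) (B n ω) (C n ω) < 0})
        =O[atTop] (fun n : ℕ => (n : ℝ) ^ (-2 : ℤ)) := by
  have hO : (fun n => (P n).real {ω | triangleDefect α (A n ω) (B n ω) (C n ω) < 0})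
      =O[atTop] (fun n : ℕ => (n : ℝ) ^ (-2 : ℤ)) := by
    refine IsBigO.of_bound 513 ?_
    filter_upwards [eventually_ge_atTop 2] with n hn
    have : NeZero n := ⟨by omega⟩
    have h := measureReal_triangleDefect_neg_le (hA n hn) (hB n hn) (hC n hn) (hind n hn) hα
    rw [Real.norm_of_nonneg measureReal_nonneg, Real.norm_of_nonneg (by positivity)]
    exact h.trans_eq (by rw [div_eq_mul_inv, zpow_neg]; norm_cast)
  refine ⟨hO.trans_tendsto ?_, hO⟩
  exact (tendsto_zpow_atTop_zero (by norm_num)).comp tendsto_natCast_atTop_atTop
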